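/- A Stone space is a compact, Hausdorff, totally disconnected topological space. A cut of a Stone space $E$ is an unordered partition $E = U \sqcup V$ of $E$ into two disjoint clopen sets; it is non-peripheral if $U$ and $V$ each contain at least two points. Two cuts $U \sqcup V$ and $U' \sqcup V'$ are compatible if at least one of the four intersections $U \cap U'$, $U \cap V'$, $V \cap U'$, $V \cap V'$ is empty. The complex of cuts $\mathscr{C}(E)$ is the simple graph whose vertices are the non-peripheral cuts of $E$, with an edge between two distinct cuts whenever they are compatible. Theorem. Let $E$ and $E'$ be second countable Stone spaces, each with at least four points, and let $\Phi\colon \mathscr{C}(E) \to \mathscr{C}(E')$ be an isomorphism of graphs. Then there exists a homeomorphism $f\colon E \to E'$ which induces $\Phi$, that is, $\Phi(U \sqcup V) = f(U) \sqcup f(V)$ for every non-peripheral cut $U \sqcup V$ of $E$. -/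

import Mathlib

open TopologicalSpace

/-- A cut of `E`: an unordered pair consisting of a clopen set and its complement, i.e. a partition
of `E` into two disjoint clopen sets (one of which may be empty). -/
def Cut (E : Type*) [TopologicalSpace E] : Type _ :=
  {c : Sym2 (Clopens E) // ∃ U : Clopens E, c = s(U, Uᶜ)}

namespace Cut

/-- `U` is one of the two sides of the cut `c`. -/
def IsSide {E : Type*} [TopologicalSpace E] (c : Cut E) (U : Clopens E) : Prop :=
  U ∈ c.1

/-- A cut is non-peripheral if each of its two sides contains at least two points. -/
def IsNonperipheral {E : Type*} [TopologicalSpace E] (c : Cut E) : Prop :=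
  ∀ U : Clopens E, c.IsSide U → (U : Set E).Nontrivial

/-- Two cuts cross if each side of the one meets each side of the other
(the four pairwise intersections are nonempty). -/
def Cross {E : Type*} [TopologicalSpace E] (c d : Cut E) : Prop :=
  ∀ U V : Clopens E, c.IsSide U → d.IsSide V → ((U : Set E) ∩ (V : Set E)).Nonempty

/-- Two cuts are compatible if they do not cross. -/
def Compatible {E : Type*} [TopologicalSpace E] (c d : Cut E) : Prop :=
  ¬ c.Cross d

theorem Cross.symm {E : Type*} [TopologicalSpace E] {c d : Cut E} (h : c.Cross d) :
    d.Cross c := fun U V hU hV => by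
  rw [Set.inter_comm]
  exact h V U hV hU

end Cut

/-- The image of a clopen set under a homeomorphism. -/
def clopenImage {E E' : Type*} [TopologicalSpace E] [TopologicalSpace E'] (f : E ≃ₜ E')
    (U : Clopens E) : Clopens E' :=
  ⟨f '' (U : Set E), f.isClosedMap _ U.isClopen.isClosed, f.isOpenMap _ U.isClopen.isOpen⟩

theorem clopenImage_compl {E E' : Type*} [TopologicalSpace E] [TopologicalSpace E'] (f : E ≃ₜ E')
    (U : Clopens E) : clopenImage f Uᶜ = (clopenImage f U)ᶜ :=
  Clopens.ext (Set.image_compl_eq f.bijective)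

/-- The image of a cut `U ⊔ V` under a homeomorphism `f` is the cut `f(U) ⊔ f(V)`. -/
def Cut.map {E E' : Type*} [TopologicalSpace E] [TopologicalSpace E'] (f : E ≃ₜ E')
    (c : Cut E) : Cut E' :=
  ⟨Sym2.map (clopenImage f) c.1, by
    obtain ⟨U, hU⟩ := c.2
    exact ⟨clopenImage f U, by rw [hU, Sym2.map_mk, clopenImage_compl]⟩⟩

/-- The non-peripheral cuts of `E`. -/
def NonperipheralCut (E : Type*) [TopologicalSpace E] : Type _ :=
  {c : Cut E // c.IsNonperipheral}

/-- The complex of cuts: the simple graph whose vertices are the non-peripheral cuts, with an edge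
between distinct cuts whenever they are compatible. -/
def cutComplex (E : Type*) [TopologicalSpace E] : SimpleGraph (NonperipheralCut E) where
  Adj c d := c ≠ d ∧ c.1.Compatible d.1
  symm := ⟨fun _ _ h => ⟨h.1.symm, fun hx => h.2 hx.symm⟩⟩
  loopless := ⟨fun _ h => h.1 rfl⟩

/-! Assume first at least five points. Every cut then has a neighbour, and each neighbour of a cut
lies strictly inside exactly one of its sides. The graph sees which: two neighbours of a cut lie on
the same side iff some neighbour of that cut is adjacent to neither (`exists_not_adj_of_same_side`,
`adj_of_opposite_sides`). So `Φ` lifts to an order isomorphism `φ` of oriented cuts commuting with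
complement (`exists_orderIso`).

A point is then recovered from the sides containing it. If `x` is not isolated, these sides are
directed downwards and compactness of `E'` gives a point common to their images. If `x` is isolated,
it is the intersection of two sides `A`, `B`; then `φ A ∩ φ B` is a single point, independent of the
pair (`MeetAt.mem_map`). The resulting bijection is a homeomorphism because sides form a subbasis.

With four points the graph has three vertices and no edges, and every bijection of vertices is
induced by a bijection of points. -/

/-- The oriented non-peripheral cuts: clopen sets which, like their complements, have at least two
points. -/
abbrev NonperipheralClopen (E : Type*) [TopologicalSpace E] : Type _ :=
  {U : Clopens E // (U : Set E).Nontrivial ∧ ((Uᶜ : Clopens E) : Set E).Nontrivial}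

/-! ### Oriented cuts as a poset with complement -/

namespace NonperipheralClopen

section Basic

variable {E : Type*} [TopologicalSpace E]

instance : Compl (NonperipheralClopen E) where
  compl U := ⟨U.1ᶜ, U.2.2, by rw [compl_compl]; exact U.2.1⟩

@[simp] theorem coe_compl (U : NonperipheralClopen E) : (Uᶜ).1 = U.1ᶜ := rfl

@[simp] theorem compl_compl' (U : NonperipheralClopen E) : Uᶜᶜ = U :=
  Subtype.ext (compl_compl U.1)

theorem mem_compl {U : NonperipheralClopen E} {x : E} : x ∈ (Uᶜ).1 ↔ x ∉ U.1 := Iff.rfl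

theorem le_iff {U V : NonperipheralClopen E} : U ≤ V ↔ ∀ x ∈ U.1, x ∈ V.1 := Iff.rfl

theorem lt_iff {U V : NonperipheralClopen E} :
    U < V ↔ (∀ x ∈ U.1, x ∈ V.1) ∧ ∃ x ∈ V.1, x ∉ U.1 := by
  rw [lt_iff_le_not_ge, le_iff, le_iff]
  push Not
  rfl

theorem ext_mem {U V : NonperipheralClopen E} (h : ∀ x, x ∈ U.1 ↔ x ∈ V.1) : U = V :=
  Subtype.ext (Clopens.ext (Set.ext h))

/-- A clopen set with two points inside and two points outside is non-peripheral. -/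
def ofMem (S : Clopens E) {a b c d : E} (ha : a ∈ S) (hb : b ∈ S) (hab : a ≠ b)
    (hc : c ∉ S) (hd : d ∉ S) (hcd : c ≠ d) : NonperipheralClopen E :=
  ⟨S, ⟨a, ha, b, hb, hab⟩, ⟨c, hc, d, hd, hcd⟩⟩

theorem exists_mem_pair (U : NonperipheralClopen E) : ∃ a b, a ∈ U.1 ∧ b ∈ U.1 ∧ a ≠ b := by
  obtain ⟨a, ha, b, hb, hab⟩ := U.2.1
  exact ⟨a, b, ha, hb, hab⟩

theorem exists_notMem_pair (U : NonperipheralClopen E) :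
    ∃ a b, a ∉ U.1 ∧ b ∉ U.1 ∧ a ≠ b := by
  obtain ⟨a, ha, b, hb, hab⟩ := U.2.2
  exact ⟨a, b, ha, hb, hab⟩

theorem exists_mem_ne (U : NonperipheralClopen E) (x : E) : ∃ a ∈ U.1, a ≠ x :=
  U.2.1.exists_ne x

theorem not_le_compl_of_le {D U : NonperipheralClopen E} (h : D ≤ U) : ¬ D ≤ Uᶜ := by
  obtain ⟨a, -, ha, -, -⟩ := D.exists_mem_pair
  exact fun h' => h' ha (h ha)

theorem compl_le_compl {U V : NonperipheralClopen E} : Uᶜ ≤ Vᶜ ↔ V ≤ U := by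
  simp only [le_iff, mem_compl]
  exact ⟨fun h x hx => by_contra fun hu => h x hu hx, fun h x hx hv => hx (h x hv)⟩

theorem compl_lt_compl {U V : NonperipheralClopen E} : Uᶜ < Vᶜ ↔ V < U := by
  rw [lt_iff_le_not_ge, lt_iff_le_not_ge, compl_le_compl, compl_le_compl]

theorem lt_compl_comm {U V : NonperipheralClopen E} : U < Vᶜ ↔ V < Uᶜ := by
  rw [← compl_lt_compl, compl_compl']

theorem compl_lt_comm {U V : NonperipheralClopen E} : Uᶜ < V ↔ Vᶜ < U := by
  rw [← compl_lt_compl, compl_compl']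

/-- The cut with sides `U` and `Uᶜ`. -/
def toCut (U : NonperipheralClopen E) : NonperipheralCut E :=
  ⟨⟨s(U.1, U.1ᶜ), U.1, rfl⟩, fun V hV => by
    rcases Sym2.mem_iff.1 hV with rfl | rfl
    · exact U.2.1
    · exact U.2.2⟩

theorem toCut_eq_iff {U V : NonperipheralClopen E} : U.toCut = V.toCut ↔ U = V ∨ U = Vᶜ := by
  constructor
  · intro h
    have h' : s(U.1, U.1ᶜ) = s(V.1, V.1ᶜ) := congrArg (fun c => c.1.1) h
    rcases Sym2.eq_iff.1 h' with h | h
    · exact Or.inl (Subtype.ext h.1)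
    · exact Or.inr (Subtype.ext h.1)
  · rintro (rfl | rfl)
    · rfl
    · apply Subtype.ext
      apply Subtype.ext
      change s(V.1ᶜ, V.1ᶜᶜ) = s(V.1, V.1ᶜ)
      rw [compl_compl, Sym2.eq_swap]

@[simp] theorem toCut_compl (U : NonperipheralClopen E) : Uᶜ.toCut = U.toCut :=
  toCut_eq_iff.2 (Or.inr rfl)

theorem toCut_surjective : Function.Surjective (toCut (E := E)) := by
  rintro ⟨⟨c, U, rfl⟩, hc⟩
  exact ⟨⟨U, hc U (Sym2.mem_mk_left _ _), hc _ (Sym2.mem_mk_right _ _)⟩, rfl⟩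

theorem cross_toCut_iff {U V : NonperipheralClopen E} : U.toCut.1.Cross V.toCut.1 ↔
    ¬ U ≤ V ∧ ¬ U ≤ Vᶜ ∧ ¬ Uᶜ ≤ V ∧ ¬ Uᶜ ≤ Vᶜ := by
  simp only [le_iff, mem_compl]
  push Not
  constructor
  · intro h
    have hU : U.toCut.1.IsSide U.1 := Sym2.mem_mk_left _ _
    have hU' : U.toCut.1.IsSide U.1ᶜ := Sym2.mem_mk_right _ _
    have hV : V.toCut.1.IsSide V.1 := Sym2.mem_mk_left _ _
    have hV' : V.toCut.1.IsSide V.1ᶜ := Sym2.mem_mk_right _ _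
    exact ⟨h _ _ hU hV', h _ _ hU hV, h _ _ hU' hV', h _ _ hU' hV⟩
  · rintro ⟨h1, h2, h3, h4⟩ A B hA hB
    rcases Sym2.mem_iff.1 hA with rfl | rfl <;> rcases Sym2.mem_iff.1 hB with rfl | rfl
    exacts [h2, h1, h4, h3]

theorem adj_toCut_iff {U V : NonperipheralClopen E} : (cutComplex E).Adj U.toCut V.toCut ↔
    U < V ∨ U < Vᶜ ∨ Uᶜ < V ∨ Uᶜ < Vᶜ := by
  change U.toCut ≠ V.toCut ∧ ¬ U.toCut.1.Cross V.toCut.1 ↔ _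
  rw [cross_toCut_iff, Ne, toCut_eq_iff]
  have e1 : Uᶜ = V ↔ U = Vᶜ :=
    ⟨fun h => by rw [← h, compl_compl'], fun h => by rw [h, compl_compl']⟩
  have e2 : Uᶜ = Vᶜ ↔ U = V :=
    ⟨fun h => by rw [← compl_compl' U, h, compl_compl'], fun h => by rw [h]⟩
  have ne : ∀ W : NonperipheralClopen E, ¬ W ≤ Wᶜ := fun W => not_le_compl_of_le le_rfl
  have ne' : ∀ W : NonperipheralClopen E, ¬ Wᶜ ≤ W := fun W h => by
    have := ne Wᶜ
    rw [compl_compl'] at this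
    exact this h
  simp only [lt_iff_le_and_ne, Ne, e1, e2]
  by_cases h : U = V
  · subst h
    simp [ne, ne']
  · by_cases h' : U = Vᶜ
    · subst h'
      simp [ne, ne']
    · simp only [h, h']
      tauto

theorem adj_toCut_of_lt {U V : NonperipheralClopen E} (h : U < V) :
    (cutComplex E).Adj U.toCut V.toCut := adj_toCut_iff.2 (Or.inl h)

theorem not_adj_toCut {U V : NonperipheralClopen E} {p q r s : E} (hp : p ∈ U.1) (hp' : p ∈ V.1)
    (hq : q ∈ U.1) (hq' : q ∉ V.1) (hr : r ∉ U.1) (hr' : r ∈ V.1) (hs : s ∉ U.1) (hs' : s ∉ V.1) :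
    ¬ (cutComplex E).Adj U.toCut V.toCut := by
  rw [adj_toCut_iff]
  rintro (h | h | h | h)
  · exact hq' (h.le hq)
  · exact h.le hp hp'
  · exact hs' (h.le hs)
  · exact h.le hr hr'

/-- Normal form of a neighbour: the side `D` chosen here tells on which side of `U.toCut` the cut
`c` lies. -/
theorem exists_lt_of_adj {U : NonperipheralClopen E} {c : NonperipheralCut E}
    (h : (cutComplex E).Adj c U.toCut) :
    ∃ D : NonperipheralClopen E, D.toCut = c ∧ (D < U ∨ D < Uᶜ) := by
  obtain ⟨D, rfl⟩ := toCut_surjective c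
  rcases adj_toCut_iff.1 h with h | h | h | h
  · exact ⟨D, rfl, Or.inl h⟩
  · exact ⟨D, rfl, Or.inr h⟩
  · exact ⟨Dᶜ, toCut_compl D, Or.inl h⟩
  · exact ⟨Dᶜ, toCut_compl D, Or.inr h⟩

/-- A cut does not have a side inside `U` and a side inside `Uᶜ`. -/
theorem toCut_ne_of_lt_of_lt_compl {U D D' : NonperipheralClopen E} (h : D < U) (h' : D' < Uᶜ) :
    D.toCut ≠ D'.toCut := by
  intro e
  rcases toCut_eq_iff.1 e with rfl | rfl
  · exact not_le_compl_of_le h.le h'.le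
  · exact lt_asymm (compl_lt_comm.1 h) h'

end Basic

/-! ### Clopen separation and point counts -/

section Stone

variable {E : Type*} [TopologicalSpace E] [CompactSpace E] [T2Space E] [TotallyDisconnectedSpace E]

theorem exists_clopen_mem_subset {x : E} {O : Set E} (hO : IsOpen O) (hx : x ∈ O) :
    ∃ G : Clopens E, x ∈ G ∧ (G : Set E) ⊆ O := by
  obtain ⟨G, hG, hxG, hGO⟩ := compact_exists_isClopen_in_isOpen hO hx
  exact ⟨⟨G, hG⟩, hxG, hGO⟩

theorem exists_clopen_separating (x : E) (F : Finset E) (hx : x ∉ F) :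
    ∃ G : Clopens E, x ∈ G ∧ ∀ y ∈ F, y ∉ G := by
  obtain ⟨G, hG, hGF⟩ := exists_clopen_mem_subset (O := (F : Set E)ᶜ)
    F.finite_toSet.isClosed.isOpen_compl (by simpa using hx)
  exact ⟨G, hG, fun y hy hyG => hGF hyG hy⟩

end Stone

end NonperipheralClopen

theorem exists_notMem_of_card_lt {E : Type*} {n : ℕ} (h : (n : ENat) < ENat.card E) (F : Finset E)
    (hF : F.card ≤ n) : ∃ e, e ∉ F := by
  by_contra! hall
  have : (Set.univ : Set E) ⊆ F := fun e _ => hall e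
  have := Set.encard_le_encard this
  rw [Set.encard_univ, Set.encard_coe_eq_coe_finsetCard] at this
  exact absurd (h.trans_le this) (by simpa using hF)

theorem exists_ne_four {E : Type*} (h : 5 ≤ ENat.card E) (a b c d : E) :
    ∃ e, e ≠ a ∧ e ≠ b ∧ e ≠ c ∧ e ≠ d := by
  classical
  obtain ⟨e, he⟩ := exists_notMem_of_card_lt (n := 4)
    (lt_of_lt_of_le (by norm_num) h) {a, b, c, d} Finset.card_le_four
  exact ⟨e, by simpa using he⟩

theorem exists_ne_three {E : Type*} (h : 4 ≤ ENat.card E) (a b c : E) :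
    ∃ e, e ≠ a ∧ e ≠ b ∧ e ≠ c := by
  classical
  obtain ⟨e, he⟩ := exists_notMem_of_card_lt (n := 3)
    (lt_of_lt_of_le (by norm_num) h) {a, b, c} Finset.card_le_three
  exact ⟨e, by simpa using he⟩

theorem five_le_card {E : Type*} {a b c d e : E} (h : [a, b, c, d, e].Nodup) :
    5 ≤ ENat.card E := by
  classical
  have h1 := Set.encard_le_encard (Set.subset_univ ([a, b, c, d, e].toFinset : Set E))
  rw [Set.encard_univ, Set.encard_coe_eq_coe_finsetCard, List.toFinset_card_of_nodup h] at h1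
  exact h1

/-! ### Detecting the sides of a cut in the graph -/

namespace NonperipheralClopen

/-- A neighbour `e` of `U.toCut` lies within one side, so it is compatible with the `Dᵢ` on the
other side. -/
theorem adj_of_opposite_sides {E : Type*} [TopologicalSpace E]
    {U D₁ D₂ : NonperipheralClopen E} (h₁ : D₁ < U)
    (h₂ : D₂ < Uᶜ) {e : NonperipheralCut E} (he : (cutComplex E).Adj U.toCut e) :
    (cutComplex E).Adj D₁.toCut e ∨ (cutComplex E).Adj D₂.toCut e := by
  obtain ⟨D, rfl, h | h⟩ := exists_lt_of_adj he.symm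
  · exact Or.inr (adj_toCut_iff.2 (Or.inr (Or.inl (h₂.trans (compl_lt_compl.2 h)))))
  · exact Or.inl (adj_toCut_iff.2 (Or.inr (Or.inl (h₁.trans (lt_compl_comm.1 h)))))

section SameSide

variable {E : Type*} [TopologicalSpace E] [CompactSpace E] [T2Space E] [TotallyDisconnectedSpace E]

/-- Some cut compatible with `U.toCut` is incompatible with both of two nested cuts inside `U`. -/
theorem exists_not_adj_of_lt_of_lt {U D₁ D₂ : NonperipheralClopen E} (h : D₁ < D₂) (h₂ : D₂ < U) :
    ∃ e, (cutComplex E).Adj U.toCut e ∧ ¬ (cutComplex E).Adj D₁.toCut e ∧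
      ¬ (cutComplex E).Adj D₂.toCut e := by
  obtain ⟨a, b, ha, hb, hab⟩ := D₁.exists_mem_pair
  obtain ⟨G, haG, hbG⟩ := exists_clopen_separating a {b} (by simpa using hab)
  replace hbG : b ∉ G := hbG b (by simp)
  obtain ⟨hU, u, hu, hu2⟩ := lt_iff.1 h₂
  obtain ⟨p, q, hp, hq, hpq⟩ := U.exists_notMem_pair
  -- `S` splits `D₁`, hence also `D₂`, by keeping `a` and dropping `b`; it reaches outside both at
  -- `u`, and misses `p`.
  let S : Clopens E := (D₁.1 ⊓ G) ⊔ (U.1 ⊓ D₂.1ᶜ)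
  have hS : ∀ x, x ∈ S ↔ (x ∈ D₁.1 ∧ x ∈ G) ∨ (x ∈ U.1 ∧ x ∉ D₂.1) := fun x => Iff.rfl
  have h1 : ∀ x, x ∈ D₁.1 → x ∈ D₂.1 := le_iff.1 h.le
  have haS : a ∈ S := (hS a).2 (Or.inl ⟨ha, haG⟩)
  have huS : u ∈ S := (hS u).2 (Or.inr ⟨hu, hu2⟩)
  have hpS : p ∉ S := by rw [hS]; have := h1 p; have := hU p; tauto
  have hqS : q ∉ S := by rw [hS]; have := h1 q; have := hU q; tauto
  have hbS : b ∉ S := by rw [hS]; have := h1 b; tauto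
  have hau : a ≠ u := fun e => hu2 (e ▸ h1 a ha)
  let e := ofMem S haS huS hau hpS hqS hpq
  have hp2 : p ∉ D₂.1 := fun h => hp (hU p h)
  refine ⟨e.toCut, (adj_toCut_of_lt (U := e) (V := U) ?_).symm,
    not_adj_toCut ha haS hb hbS (fun h => hu2 (h1 u h)) huS (fun h => hp2 (h1 p h)) hpS,
    not_adj_toCut (h1 a ha) haS (h1 b hb) hbS hu2 huS hp2 hpS⟩
  rw [lt_iff]
  refine ⟨fun x hx => ?_, b, hU b (h1 b hb), hbS⟩
  have := (hS x).1 hx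
  have := h1 x
  have := hU x
  tauto

/-- Some cut compatible with `U.toCut` is incompatible with both of two disjoint cuts
inside `U`. -/
theorem exists_not_adj_of_lt_compl {U D₁ D₂ : NonperipheralClopen E} (h₁ : D₁ < U) (h₂ : D₂ < U)
    (h : D₁ < D₂ᶜ) :
    ∃ e, (cutComplex E).Adj U.toCut e ∧ ¬ (cutComplex E).Adj D₁.toCut e ∧
      ¬ (cutComplex E).Adj D₂.toCut e := by
  obtain ⟨a, b, ha, hb, hab⟩ := D₁.exists_mem_pair
  obtain ⟨G, haG, hbG⟩ := exists_clopen_separating a {b} (by simpa using hab)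
  replace hbG : b ∉ G := hbG b (by simp)
  obtain ⟨c, d, hc, hd, hcd⟩ := D₂.exists_mem_pair
  obtain ⟨H, hcH, hdH⟩ := exists_clopen_separating c {d} (by simpa using hcd)
  replace hdH : d ∉ H := hdH d (by simp)
  obtain ⟨p, q, hp, hq, hpq⟩ := U.exists_notMem_pair
  -- A piece of `D₁` together with a piece of `D₂`: it splits both.
  let S : Clopens E := (D₁.1 ⊓ G) ⊔ (D₂.1 ⊓ H)
  have hS : ∀ x, x ∈ S ↔ (x ∈ D₁.1 ∧ x ∈ G) ∨ (x ∈ D₂.1 ∧ x ∈ H) := fun x => Iff.rfl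
  have h12 : ∀ x, x ∈ D₁.1 → x ∉ D₂.1 := le_iff.1 h.le
  have h1 : ∀ x, x ∈ D₁.1 → x ∈ U.1 := le_iff.1 h₁.le
  have h2 : ∀ x, x ∈ D₂.1 → x ∈ U.1 := le_iff.1 h₂.le
  have haS : a ∈ S := (hS a).2 (Or.inl ⟨ha, haG⟩)
  have hcS : c ∈ S := (hS c).2 (Or.inr ⟨hc, hcH⟩)
  have hpS : p ∉ S := by rw [hS]; have := h1 p; have := h2 p; tauto
  have hqS : q ∉ S := by rw [hS]; have := h1 q; have := h2 q; tauto
  have hbS : b ∉ S := by rw [hS]; have := h12 b; tauto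
  have hdS : d ∉ S := by rw [hS]; have := h12 d; tauto
  have hac : a ≠ c := fun e => h12 a ha (e ▸ hc)
  let e := ofMem S haS hcS hac hpS hqS hpq
  refine ⟨e.toCut, (adj_toCut_of_lt (U := e) (V := U) ?_).symm,
    not_adj_toCut ha haS hb hbS (fun h => h12 c h hc) hcS (fun h => hp (h1 p h)) hpS,
    not_adj_toCut hc hcS hd hdS (h12 a ha) haS (fun h => hp (h2 p h)) hpS⟩
  rw [lt_iff]
  refine ⟨fun x hx => ?_, b, h1 b hb, hbS⟩
  have := (hS x).1 hx
  have := h1 x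
  have := h2 x
  tauto

/-- Two cuts compatible with `U.toCut` lie on the same side of it if some cut compatible with
`U.toCut` is incompatible with both of them. -/
theorem exists_not_adj_of_same_side {U D₁ D₂ : NonperipheralClopen E} (h₁ : D₁ < U) (h₂ : D₂ < U) :
    ∃ e, (cutComplex E).Adj U.toCut e ∧ ¬ (cutComplex E).Adj D₁.toCut e ∧
      ¬ (cutComplex E).Adj D₂.toCut e := by
  by_cases hadj : (cutComplex E).Adj D₁.toCut D₂.toCut
  · rcases adj_toCut_iff.1 hadj with h | h | h | h
    · exact exists_not_adj_of_lt_of_lt h h₂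
    · exact exists_not_adj_of_lt_compl h₁ h₂ h
    -- Here `D₁` and `D₂` would cover `E`, although both lie in `U`.
    · obtain ⟨p, -, hp, -, -⟩ := U.exists_notMem_pair
      exact absurd (h₂.le (h.le fun h' => hp (h₁.le h'))) hp
    · obtain ⟨e, he, he1, he2⟩ := exists_not_adj_of_lt_of_lt (compl_lt_compl.1 h) h₁
      exact ⟨e, he, he2, he1⟩
  -- If the two cuts are not adjacent, `D₁.toCut` itself is a witness, as it is not adjacent to
  -- itself.
  · exact ⟨D₁.toCut, (adj_toCut_of_lt h₁).symm, SimpleGraph.irrefl _, fun h => hadj h.symm⟩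

end SameSide

/-! ### Lifting `Φ` to oriented cuts -/

/-- `U'` is the side of the cut `Φ U.toCut` that corresponds to the side `U` of `U.toCut`: cuts
inside `U` are sent to cuts inside `U'`, and cuts inside `Uᶜ` to cuts inside `U'ᶜ`. -/
structure IsLift {E E' : Type*} [TopologicalSpace E] [TopologicalSpace E']
    (Φ : cutComplex E ≃g cutComplex E')
    (U : NonperipheralClopen E) (U' : NonperipheralClopen E') : Prop where
  toCut_eq : U'.toCut = Φ U.toCut
  exists_lt : ∀ D, D < U → ∃ D', D' < U' ∧ D'.toCut = Φ D.toCut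
  exists_lt_compl : ∀ D, D < Uᶜ → ∃ D', D' < U'ᶜ ∧ D'.toCut = Φ D.toCut

namespace IsLift

variable {E E' : Type*} [TopologicalSpace E] [TopologicalSpace E']
  {Φ : cutComplex E ≃g cutComplex E'}

theorem compl {U : NonperipheralClopen E} {U' : NonperipheralClopen E'} (h : IsLift Φ U U') :
    IsLift Φ Uᶜ U'ᶜ := by
  refine ⟨?_, h.exists_lt_compl, ?_⟩
  · rw [toCut_compl, toCut_compl, h.toCut_eq]
  · simpa only [compl_compl'] using h.exists_lt

theorem symm_exists_lt {U : NonperipheralClopen E} {U' : NonperipheralClopen E'}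
    (h : IsLift Φ U U') (D' : NonperipheralClopen E') (hD' : D' < U') :
    ∃ D, D < U ∧ D.toCut = Φ.symm D'.toCut := by
  have hadj : (cutComplex E).Adj (Φ.symm D'.toCut) U.toCut := by
    rw [← Φ.map_adj_iff, Φ.apply_symm_apply, ← h.toCut_eq]
    exact adj_toCut_of_lt hD'
  obtain ⟨D, hD, hlt | hlt⟩ := exists_lt_of_adj hadj
  · exact ⟨D, hlt, hD⟩
  · obtain ⟨D'', hlt', hD''⟩ := h.exists_lt_compl D hlt
    rw [hD, Φ.apply_symm_apply] at hD''
    exact absurd hD''.symm (toCut_ne_of_lt_of_lt_compl hD' hlt')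

theorem symm {U : NonperipheralClopen E} {U' : NonperipheralClopen E'} (h : IsLift Φ U U') :
    IsLift Φ.symm U' U :=
  ⟨by rw [h.toCut_eq, Φ.symm_apply_apply], h.symm_exists_lt, h.compl.symm_exists_lt⟩

/-- Lifting `U` inside `V` puts `U'` or `U'ᶜ` below `V'`. In the second case, lifting `Vᶜ` inside
`Uᶜ` puts `V'` or `V'ᶜ` below `U'ᶜ`: the former is absurd, the latter is the claim. -/
theorem lt {U V : NonperipheralClopen E} {U' V' : NonperipheralClopen E'} (hU : IsLift Φ U U')
    (hV : IsLift Φ V V') (h : U < V) : U' < V' := by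
  obtain ⟨D, hD, hDU⟩ := hV.exists_lt U h
  rw [← hU.toCut_eq] at hDU
  rcases toCut_eq_iff.1 hDU with rfl | rfl
  · exact hD
  · obtain ⟨D, hD', hDV⟩ := hU.exists_lt_compl Vᶜ (compl_lt_compl.2 h)
    rw [toCut_compl, ← hV.toCut_eq] at hDV
    rcases toCut_eq_iff.1 hDV with rfl | rfl
    · exact absurd hD' (lt_asymm hD)
    · exact compl_lt_compl.1 hD'

/-- The neighbour `D` is needed: for a cut with none, both sides of the image cut would be lifts
vacuously. -/
theorem unique {U : NonperipheralClopen E} {V W : NonperipheralClopen E'}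
    (hU : ∃ D, D < U ∨ D < Uᶜ) (hV : IsLift Φ U V) (hW : IsLift Φ U W) : V = W := by
  rcases toCut_eq_iff.1 (hV.toCut_eq.trans hW.toCut_eq.symm) with h | rfl
  · exact h
  · obtain ⟨D, hD | hD⟩ := hU
    · obtain ⟨D₁, h1, e1⟩ := hV.exists_lt D hD
      obtain ⟨D₂, h2, e2⟩ := hW.exists_lt D hD
      exact absurd (e2.trans e1.symm) (toCut_ne_of_lt_of_lt_compl h2 h1)
    · obtain ⟨D₁, h1, e1⟩ := hV.exists_lt_compl D hD
      obtain ⟨D₂, h2, e2⟩ := hW.exists_lt_compl D hD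
      exact absurd (e2.trans e1.symm)
        (toCut_ne_of_lt_of_lt_compl h2 h1)

end IsLift

theorem exists_map_lt {E E' : Type*} [TopologicalSpace E] [TopologicalSpace E']
    (Φ : cutComplex E ≃g cutComplex E') {U D : NonperipheralClopen E}
    {U' : NonperipheralClopen E'} (hU : U'.toCut = Φ U.toCut) (h : D < U ∨ D < Uᶜ) :
    ∃ D', (D' < U' ∨ D' < U'ᶜ) ∧ D'.toCut = Φ D.toCut := by
  have hadj : (cutComplex E').Adj (Φ D.toCut) U'.toCut := by
    rw [hU, Φ.map_adj_iff]
    rcases h with h | h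
    · exact adj_toCut_of_lt h
    · rw [← toCut_compl U]
      exact adj_toCut_of_lt h
  obtain ⟨D', e, h'⟩ := exists_lt_of_adj hadj
  exact ⟨D', h', e⟩

section Stone

variable {E : Type*} [TopologicalSpace E] [CompactSpace E] [T2Space E] [TotallyDisconnectedSpace E]
  {E' : Type*} [TopologicalSpace E'] [CompactSpace E'] [T2Space E'] [TotallyDisconnectedSpace E']

theorem map_same_side {E' : Type*} [TopologicalSpace E'] (Φ : cutComplex E ≃g cutComplex E')
    {U D₁ D₂ : NonperipheralClopen E} {U' D₁' D₂' : NonperipheralClopen E'}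
    (hU : U'.toCut = Φ U.toCut)
    (e₁ : D₁'.toCut = Φ D₁.toCut) (e₂ : D₂'.toCut = Φ D₂.toCut)
    (h₁ : D₁ < U) (h₂ : D₂ < U) (h₁' : D₁' < U') (h₂' : D₂' < U'ᶜ) : False := by
  obtain ⟨e, he, he1, he2⟩ := exists_not_adj_of_same_side h₁ h₂
  rw [← Φ.map_adj_iff] at he he1 he2
  rw [← hU] at he
  rw [← e₁] at he1
  rw [← e₂] at he2
  exact (adj_of_opposite_sides h₁' h₂' he).elim he1 he2

/-- One matched neighbour decides for all: `Φ` does not separate neighbours on the same side, and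
`Φ.symm` does not either. -/
theorem isLift_of_lt (Φ : cutComplex E ≃g cutComplex E') {U D : NonperipheralClopen E}
    {U' D' : NonperipheralClopen E'} (hU : U'.toCut = Φ U.toCut) (e : D'.toCut = Φ D.toCut)
    (h : D < U) (h' : D' < U') : IsLift Φ U U' := by
  refine ⟨hU, fun D₂ h₂ => ?_, fun D₂ h₂ => ?_⟩
  · obtain ⟨D₂', h₂' | h₂', e₂⟩ := exists_map_lt Φ hU (Or.inl h₂)
    · exact ⟨D₂', h₂', e₂⟩
    · exact (map_same_side Φ hU e e₂ h h₂ h' h₂').elim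
  · obtain ⟨D₂', h₂' | h₂', e₂⟩ := exists_map_lt Φ hU (Or.inr h₂)
    · have inv : ∀ {A : NonperipheralClopen E} {A' : NonperipheralClopen E'},
          A'.toCut = Φ A.toCut → A.toCut = Φ.symm A'.toCut := fun h => by
        rw [h, Φ.symm_apply_apply]
      exact (map_same_side Φ.symm (inv hU) (inv e) (inv e₂) h' h₂' h h₂).elim
    · exact ⟨D₂', h₂', e₂⟩

theorem exists_isLift (Φ : cutComplex E ≃g cutComplex E') {U : NonperipheralClopen E}
    (hU : ∃ D, D < U ∨ D < Uᶜ) : ∃ U', IsLift Φ U U' := by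
  have key : ∀ V D : NonperipheralClopen E, D < V → ∃ V', IsLift Φ V V' := by
    intro V D h
    obtain ⟨V', hV'⟩ := toCut_surjective (Φ V.toCut)
    obtain ⟨D', h' | h', e⟩ := exists_map_lt Φ hV' (Or.inl h)
    · exact ⟨V', isLift_of_lt Φ hV' e h h'⟩
    · exact ⟨V'ᶜ, isLift_of_lt Φ ((toCut_compl V').trans hV') e h h'⟩
  obtain ⟨D, h | h⟩ := hU
  · exact key U D h
  · obtain ⟨V', hV'⟩ := key Uᶜ D h
    exact ⟨V'ᶜ, by simpa only [compl_compl'] using hV'.compl⟩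

theorem exists_lt_of_three_mem {U : NonperipheralClopen E} {a b c : E} (ha : a ∈ U.1)
    (hb : b ∈ U.1) (hc : c ∈ U.1) (hab : a ≠ b) (hac : a ≠ c) (hbc : b ≠ c) : ∃ D, D < U := by
  classical
  obtain ⟨G, haG, hG⟩ := exists_clopen_separating a {b, c} (by simp [hab, hac])
  obtain ⟨p, q, hp, hq, hpq⟩ := U.exists_notMem_pair
  have hS : ∀ x, x ∈ U.1 ⊓ Gᶜ ↔ x ∈ U.1 ∧ x ∉ G := fun x => Iff.rfl
  refine ⟨ofMem (U.1 ⊓ Gᶜ) ((hS b).2 ⟨hb, hG b (by simp)⟩) ((hS c).2 ⟨hc, hG c (by simp)⟩) hbc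
    (fun h => hp ((hS p).1 h).1) (fun h => hq ((hS q).1 h).1) hpq, ?_⟩
  exact lt_iff.2 ⟨fun x hx => ((hS x).1 hx).1, a, ha, fun h => ((hS a).1 h).2 haG⟩

theorem exists_lt_or_lt_compl (h5 : 5 ≤ ENat.card E) (U : NonperipheralClopen E) :
    ∃ D, D < U ∨ D < Uᶜ := by
  obtain ⟨a, b, ha, hb, hab⟩ := U.exists_mem_pair
  obtain ⟨c, d, hc, hd, hcd⟩ := U.exists_notMem_pair
  obtain ⟨e, hea, heb, hec, hed⟩ := exists_ne_four h5 a b c d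
  by_cases he : e ∈ U.1
  · obtain ⟨D, hD⟩ := exists_lt_of_three_mem he ha hb hea heb hab
    exact ⟨D, Or.inl hD⟩
  · obtain ⟨D, hD⟩ := exists_lt_of_three_mem (U := Uᶜ) he hc hd hec hed hcd
    exact ⟨D, Or.inr hD⟩

/-- An isomorphism of complexes of cuts lifts to an isomorphism of the posets of sides which
commutes with complements. -/
theorem exists_orderIso (h5 : 5 ≤ ENat.card E) (h5' : 5 ≤ ENat.card E')
    (Φ : cutComplex E ≃g cutComplex E') :
    ∃ φ : NonperipheralClopen E ≃o NonperipheralClopen E',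
      (∀ U, φ Uᶜ = (φ U)ᶜ) ∧ ∀ U, (φ U).toCut = Φ U.toCut := by
  choose φ hφ using fun U : NonperipheralClopen E => exists_isLift Φ (exists_lt_or_lt_compl h5 U)
  choose ψ hψ using fun U : NonperipheralClopen E' =>
    exists_isLift Φ.symm (exists_lt_or_lt_compl h5' U)
  have hψφ : ∀ U, ψ (φ U) = U := fun U =>
    (hψ (φ U)).unique (exists_lt_or_lt_compl h5' _) (hφ U).symm
  have hφψ : ∀ V, φ (ψ V) = V := fun V =>
    (hφ (ψ V)).unique (exists_lt_or_lt_compl h5 _) (hψ V).symm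
  refine ⟨⟨⟨φ, ψ, hψφ, hφψ⟩, ?_⟩, ?_, fun U => (hφ U).toCut_eq⟩
  · intro U V
    change φ U ≤ φ V ↔ U ≤ V
    refine ⟨fun h => ?_, fun h => ?_⟩
    · rcases h.eq_or_lt with h | h
      · rw [← hψφ U, h, hψφ]
      · have := (hψ _).lt (hψ _) h
        rw [hψφ, hψφ] at this
        exact this.le
    · rcases h.eq_or_lt with rfl | h
      · exact le_rfl
      · exact ((hφ _).lt (hφ _) h).le
  · exact fun U => (hφ Uᶜ).unique (exists_lt_or_lt_compl h5 _) (hφ U).compl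

/-- With `exists_adj`, this makes "at least five points" equivalent to the graph having an edge, so
`Φ` preserves it. -/
theorem five_le_card_of_lt {E : Type*} [TopologicalSpace E] {U V : NonperipheralClopen E}
    (h : U < V) : 5 ≤ ENat.card E := by
  obtain ⟨hUV, c, hc, hcU⟩ := lt_iff.1 h
  obtain ⟨a, b, ha, hb, hab⟩ := U.exists_mem_pair
  obtain ⟨p, q, hp, hq, hpq⟩ := V.exists_notMem_pair
  have ne : ∀ {W : Clopens E} {x y : E}, x ∈ W → y ∉ W → x ≠ y := fun hx hy e => hy (e ▸ hx)
  have haV := hUV a ha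
  have hbV := hUV b hb
  refine five_le_card (a := a) (b := b) (c := c) (d := p) (e := q) ?_
  simp [hab, hpq, ne ha hcU, ne hb hcU, ne haV hp, ne haV hq, ne hbV hp, ne hbV hq, ne hc hp,
    ne hc hq]

theorem five_le_card_of_adj {E : Type*} [TopologicalSpace E] {c d : NonperipheralCut E}
    (h : (cutComplex E).Adj c d) : 5 ≤ ENat.card E := by
  obtain ⟨U, rfl⟩ := toCut_surjective d
  obtain ⟨D, -, h | h⟩ := exists_lt_of_adj h
  exacts [five_le_card_of_lt h, five_le_card_of_lt h]

/-- Distinct points are separated by a non-peripheral clopen set. -/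
theorem exists_mem_notMem (h4 : 4 ≤ ENat.card E) {x y : E} (hxy : x ≠ y) :
    ∃ U : NonperipheralClopen E, x ∈ U.1 ∧ y ∉ U.1 := by
  classical
  obtain ⟨a, hax, hay, -⟩ := exists_ne_three h4 x y x
  obtain ⟨b, hbx, hby, hba⟩ := exists_ne_three h4 x y a
  obtain ⟨G, hxG, hG⟩ := exists_clopen_separating x {y, b} (by simp [hxy, hbx.symm])
  obtain ⟨H, haH, hH⟩ := exists_clopen_separating a {y, b} (by simp [hay, hba.symm])
  have hS : ∀ z, z ∈ G ⊔ H ↔ z ∈ G ∨ z ∈ H := fun z => Iff.rfl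
  have hy : y ∉ G ⊔ H := fun h => ((hS y).1 h).elim (hG y (by simp)) (hH y (by simp))
  have hb : b ∉ G ⊔ H := fun h => ((hS b).1 h).elim (hG b (by simp)) (hH b (by simp))
  exact ⟨ofMem (G ⊔ H) ((hS x).2 (Or.inl hxG)) ((hS a).2 (Or.inr haH)) hax.symm hy hb hby.symm,
    (hS x).2 (Or.inl hxG), hy⟩

theorem exists_adj (h5 : 5 ≤ ENat.card E) : ∃ c d, (cutComplex E).Adj c d := by
  have h4 : 4 ≤ ENat.card E := le_trans (by norm_num) h5
  obtain ⟨x, -⟩ := exists_notMem_of_card_lt (n := 0) (lt_of_lt_of_le (by norm_num) h5)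
    (∅ : Finset E) le_rfl
  obtain ⟨y, hy, -⟩ := exists_ne_three h4 x x x
  obtain ⟨U, -⟩ := exists_mem_notMem h4 hy
  obtain ⟨D, h | h⟩ := exists_lt_or_lt_compl h5 U
  exacts [⟨_, _, adj_toCut_of_lt h⟩, ⟨_, _, adj_toCut_of_lt h⟩]

end Stone

/-! ### Recovering points from sides -/

/-- The sets `A` and `B` meet exactly in the point `x`. -/
structure MeetAt {E : Type*} [TopologicalSpace E] (A B : NonperipheralClopen E) (x : E) : Prop where
  mem_left : x ∈ A.1
  mem_right : x ∈ B.1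
  eq : ∀ z, z ∈ A.1 → z ∈ B.1 → z = x

theorem MeetAt.symm {E : Type*} [TopologicalSpace E] {A B : NonperipheralClopen E} {x : E}
    (h : MeetAt A B x) : MeetAt B A x :=
  ⟨h.mem_right, h.mem_left, fun z hB hA => h.eq z hA hB⟩

section Poset

variable {E : Type*} [TopologicalSpace E] {E' : Type*} [TopologicalSpace E']
  {φ : NonperipheralClopen E ≃o NonperipheralClopen E'}

theorem mem_map_of_le {U V : NonperipheralClopen E} (h : U ≤ V) {y : E'} (hy : y ∈ (φ U).1) :
    y ∈ (φ V).1 :=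
  le_iff.1 (φ.monotone h) y hy

/-- Disjointness is the order relation `A ≤ Bᶜ`, which `φ` reflects. -/
theorem exists_mem_map (hφ : ∀ U, φ Uᶜ = (φ U)ᶜ) {A B : NonperipheralClopen E} {x : E}
    (hA : x ∈ A.1) (hB : x ∈ B.1) :
    ∃ y, y ∈ (φ A).1 ∧ y ∈ (φ B).1 := by
  by_contra! h
  have h1 : φ A ≤ φ Bᶜ := by
    rw [hφ]
    exact h
  exact le_iff.1 (φ.le_iff_le.1 h1) x hA hB

/-- If `φ A ∩ φ B` had two points it would be a non-peripheral side, and its preimage would be a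
side contained in `{x}`. -/
theorem MeetAt.map_eq {A B : NonperipheralClopen E} {x : E} (h : MeetAt A B x) {y z : E'}
    (hy : y ∈ (φ A).1) (hy' : y ∈ (φ B).1) (hz : z ∈ (φ A).1) (hz' : z ∈ (φ B).1) : y = z := by
  by_contra hne
  obtain ⟨p, q, hp, hq, hpq⟩ := (φ A).exists_notMem_pair
  let S : NonperipheralClopen E' := ofMem ((φ A).1 ⊓ (φ B).1) (a := y) (b := z) ⟨hy, hy'⟩ ⟨hz, hz'⟩
    hne (c := p) (d := q) (fun h => hp h.1) (fun h => hq h.1) hpq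
  have hSA : φ.symm S ≤ A := φ.symm_apply_le.2 fun _ h => h.1
  have hSB : φ.symm S ≤ B := φ.symm_apply_le.2 fun _ h => h.2
  obtain ⟨a, ha, hax⟩ := (φ.symm S).exists_mem_ne x
  exact hax (h.eq a (le_iff.1 hSA a ha) (le_iff.1 hSB a ha))

theorem MeetAt.mem_map_of_le (hφ : ∀ U, φ Uᶜ = (φ U)ᶜ) {A A' B : NonperipheralClopen E} {x : E}
    (h : MeetAt A B x) (h' : MeetAt A' B x) (hle : A ≤ A') {y : E'} (hy : y ∈ (φ A').1)
    (hy' : y ∈ (φ B).1) :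
    y ∈ (φ A).1 := by
  obtain ⟨z, hz, hz'⟩ := exists_mem_map hφ h.mem_left h.mem_right
  rwa [h'.map_eq hy hy' (NonperipheralClopen.mem_map_of_le hle hz) hz']

end Poset

section Stone

variable {E : Type*} [TopologicalSpace E] [CompactSpace E] [T2Space E] [TotallyDisconnectedSpace E]
  {E' : Type*} [TopologicalSpace E']
  {φ : NonperipheralClopen E ≃o NonperipheralClopen E'}

theorem MeetAt.mem_map_left (hφ : ∀ U, φ Uᶜ = (φ U)ᶜ) (h5 : 5 ≤ ENat.card E)
    {A A' B : NonperipheralClopen E} {x : E} (h : MeetAt A B x) (h' : MeetAt A' B x) {y : E'}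
    (hy : y ∈ (φ A).1) (hy' : y ∈ (φ B).1) : y ∈ (φ A').1 := by
  classical
  obtain ⟨a, ha, hax⟩ := A.exists_mem_ne x
  obtain ⟨a', ha', hax'⟩ := A'.exists_mem_ne x
  obtain ⟨b, hb, hbx⟩ := B.exists_mem_ne x
  -- The path is `A ≥ C ≤ D ≥ C' ≤ A'`, each meeting `B` in `x` alone. Cutting out a neighbourhood
  -- of a fifth point `e` leaves `b` and `e` outside `D = C ∪ C'`, so `D` is non-peripheral.
  obtain ⟨e, hex, hea, hea', heb⟩ := exists_ne_four h5 x a a' b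
  obtain ⟨G, heG, hG⟩ := exists_clopen_separating e {x, a, a', b} (by simp [hex, hea, hea', heb])
  have hxG : x ∉ G := hG x (by simp)
  have haG : a ∉ G := hG a (by simp)
  have haG' : a' ∉ G := hG a' (by simp)
  have hbA : b ∉ A.1 := fun hA => hbx (h.eq b hA hb)
  have hbA' : b ∉ A'.1 := fun hA => hbx (h'.eq b hA hb)
  let C : NonperipheralClopen E := ofMem (A.1 ⊓ Gᶜ) (a := x) (b := a) (c := b) (d := e)
    ⟨h.mem_left, hxG⟩ ⟨ha, haG⟩ hax.symm (fun k => hbA k.1) (fun k => k.2 heG) heb.symm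
  let C' : NonperipheralClopen E := ofMem (A'.1 ⊓ Gᶜ) (a := x) (b := a') (c := b) (d := e)
    ⟨h'.mem_left, hxG⟩ ⟨ha', haG'⟩ hax'.symm (fun k => hbA' k.1) (fun k => k.2 heG) heb.symm
  let D : NonperipheralClopen E := ofMem (C.1 ⊔ C'.1) (a := x) (b := a) (c := b) (d := e)
    (Or.inl ⟨h.mem_left, hxG⟩) (Or.inl ⟨ha, haG⟩) hax.symm
    (fun k => k.elim (fun k => hbA k.1) (fun k => hbA' k.1))
    (fun k => k.elim (fun k => k.2 heG) (fun k => k.2 heG)) heb.symm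
  have hC : MeetAt C B x := ⟨⟨h.mem_left, hxG⟩, h.mem_right, fun z k => h.eq z k.1⟩
  have hC' : MeetAt C' B x := ⟨⟨h'.mem_left, hxG⟩, h.mem_right, fun z k => h'.eq z k.1⟩
  have hD : MeetAt D B x := ⟨Or.inl ⟨h.mem_left, hxG⟩, h.mem_right, fun z k kB =>
    k.elim (fun k => h.eq z k.1 kB) (fun k => h'.eq z k.1 kB)⟩
  have y1 : y ∈ (φ C).1 := hC.mem_map_of_le hφ h (fun _ k => k.1) hy hy'
  have y2 : y ∈ (φ D).1 := NonperipheralClopen.mem_map_of_le (U := C) (V := D) (fun _ k => Or.inl k) y1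
  have y3 : y ∈ (φ C').1 := hC'.mem_map_of_le hφ hD (fun _ k => Or.inr k) y2 hy'
  exact NonperipheralClopen.mem_map_of_le (U := C') (fun _ k => k.1) y3

/-- One set is changed at a time: `(A, B)`, `(C, B)`, `(C, D)`, `(A', D)`, `(A', B')`. With `G`
containing `a` but not `b'`, the sets `C = A ∩ (G ∪ B)` and `D = B' \ G` meet inside `A ∩ B`, yet
each keeps a point besides `x`. -/
theorem MeetAt.mem_map_of_ne (hφ : ∀ U, φ Uᶜ = (φ U)ᶜ) (h5 : 5 ≤ ENat.card E)
    {A B A' B' : NonperipheralClopen E} {x a b' : E} (h : MeetAt A B x) (h' : MeetAt A' B' x)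
    (ha : a ∈ A.1) (hax : a ≠ x) (hb' : b' ∈ B'.1) (hbx' : b' ≠ x) (hab : a ≠ b')
    {y : E'} (hy : y ∈ (φ A).1) (hy' : y ∈ (φ B).1) : y ∈ (φ A').1 ∧ y ∈ (φ B').1 := by
  classical
  obtain ⟨G, haG, hG⟩ := exists_clopen_separating a {x, b'} (by simp [hax, hab])
  have hxG : x ∉ G := hG x (by simp)
  have hbG' : b' ∉ G := hG b' (by simp)
  obtain ⟨p, q, hp, hq, hpq⟩ := A.exists_notMem_pair
  obtain ⟨r, s, hr, hs, hrs⟩ := B'.exists_notMem_pair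
  let C : NonperipheralClopen E := ofMem (A.1 ⊓ (G ⊔ B.1)) (a := x) (b := a) (c := p) (d := q)
    ⟨h.mem_left, Or.inr h.mem_right⟩ ⟨ha, Or.inl haG⟩ hax.symm
    (fun k => hp k.1) (fun k => hq k.1) hpq
  let D : NonperipheralClopen E := ofMem (B'.1 ⊓ Gᶜ) (a := x) (b := b') (c := r) (d := s)
    ⟨h'.mem_right, hxG⟩ ⟨hb', hbG'⟩ hbx'.symm (fun k => hr k.1) (fun k => hs k.1) hrs
  have hCB : MeetAt C B x := ⟨⟨h.mem_left, Or.inr h.mem_right⟩, h.mem_right, fun z k => h.eq z k.1⟩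
  have hCD : MeetAt C D x := ⟨hCB.mem_left, ⟨h'.mem_right, hxG⟩, fun z k k' =>
    h.eq z k.1 (k.2.resolve_left k'.2)⟩
  have hAD : MeetAt A' D x := ⟨h'.mem_left, hCD.mem_right, fun z k k' => h'.eq z k k'.1⟩
  have y1 : y ∈ (φ C).1 := hCB.mem_map_of_le hφ h (fun _ k => k.1) hy hy'
  have y2 : y ∈ (φ D).1 := hCB.symm.mem_map_left hφ h5 hCD.symm hy' y1
  exact ⟨hCD.mem_map_left hφ h5 hAD y1 y2,
    NonperipheralClopen.mem_map_of_le (U := D) (fun _ k => k.1) y2⟩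

theorem MeetAt.mem_map (hφ : ∀ U, φ Uᶜ = (φ U)ᶜ) (h5 : 5 ≤ ENat.card E)
    {A B A' B' : NonperipheralClopen E} {x : E} (h : MeetAt A B x) (h' : MeetAt A' B' x) {y : E'}
    (hy : y ∈ (φ A).1) (hy' : y ∈ (φ B).1) : y ∈ (φ A').1 ∧ y ∈ (φ B').1 := by
  obtain ⟨a, ha, hax⟩ := A.exists_mem_ne x
  obtain ⟨a', ha', hax'⟩ := A'.exists_mem_ne x
  obtain ⟨b', hb', hbx'⟩ := B'.exists_mem_ne x
  by_cases hab : a = b'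
  · subst hab
    -- Now `a` lies in `B'`, so it is not in `A'`; exchanging `A'` and `B'` gives distinct points.
    have hne : a ≠ a' := fun e => hax' (h'.eq a' ha' (e ▸ hb'))
    exact (h.mem_map_of_ne hφ h5 h'.symm ha hax ha' hax' hne hy hy').symm
  · exact h.mem_map_of_ne hφ h5 h' ha hax hb' hbx' hab hy hy'

theorem exists_meetAt {x : E} (hx : IsOpen {x}) {U : NonperipheralClopen E} (hxU : x ∈ U.1) :
    ∃ B, MeetAt U B x := by
  obtain ⟨u, hu, hux⟩ := U.exists_mem_ne x
  obtain ⟨b, e, hb, he, hbe⟩ := U.exists_notMem_pair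
  obtain ⟨G, heG, hG⟩ := exists_clopen_separating e {b} (by simpa using hbe.symm)
  have ne : ∀ {z}, z ∉ U.1 → z ≠ x := fun hz h => hz (h ▸ hxU)
  let X : Clopens E := ⟨{x}, isClosed_singleton, hx⟩
  refine ⟨ofMem (X ⊔ (U.1ᶜ ⊓ Gᶜ)) (a := x) (b := b) (c := u) (d := e) (Or.inl rfl)
    (Or.inr ⟨hb, hG b (by simp)⟩) (ne hb).symm (fun k => k.elim hux fun k => k.1 hu)
    (fun k => k.elim (ne he) fun k => k.2 heG) (fun h => he (h ▸ hu)), hxU, Or.inl rfl,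
    fun z hz k => k.elim id fun k => absurd hz k.1⟩

theorem exists_mem_map_of_isOpen (hφ : ∀ U, φ Uᶜ = (φ U)ᶜ) (h5 : 5 ≤ ENat.card E) {x : E}
    (hx : IsOpen {x}) : ∃ y, ∀ U : NonperipheralClopen E, x ∈ U.1 → y ∈ (φ U).1 := by
  have h4 : 4 ≤ ENat.card E := le_trans (by norm_num) h5
  obtain ⟨z, hz, -⟩ := exists_ne_three h4 x x x
  obtain ⟨A, hxA, -⟩ := exists_mem_notMem h4 hz.symm
  obtain ⟨B, hAB⟩ := exists_meetAt hx hxA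
  obtain ⟨y, hyA, hyB⟩ := exists_mem_map hφ hAB.mem_left hAB.mem_right
  refine ⟨y, fun U hU => ?_⟩
  obtain ⟨B', hUB⟩ := exists_meetAt hx hU
  exact (hAB.mem_map hφ h5 hUB hyA hyB).1

theorem exists_mem_map_of_not_isOpen [CompactSpace E'] (h4 : 4 ≤ ENat.card E) {x : E}
    (hx : ¬ IsOpen {x}) : ∃ y, ∀ U : NonperipheralClopen E, x ∈ U.1 → y ∈ (φ U).1 := by
  obtain ⟨z, hz, -⟩ := exists_ne_three h4 x x x
  obtain ⟨A, hxA, -⟩ := exists_mem_notMem h4 hz.symm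
  have : Nonempty {U : NonperipheralClopen E // x ∈ U.1} := ⟨⟨A, hxA⟩⟩
  have key := IsCompact.nonempty_iInter_of_directed_nonempty_isCompact_isClosed
    (fun U : {U : NonperipheralClopen E // x ∈ U.1} => ((φ U.1).1 : Set E')) ?_
    (fun U => (φ U.1).2.1.nonempty) (fun U => (φ U.1).1.isClopen.isClosed.isCompact)
    (fun U => (φ U.1).1.isClopen.isClosed)
  · obtain ⟨y, hy⟩ := key
    exact ⟨y, fun U hU => Set.mem_iInter.1 hy ⟨U, hU⟩⟩
  · rintro ⟨U, hU⟩ ⟨V, hV⟩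
    -- As `x` is not isolated, `U ∩ V` has a second point, so it is again a side containing `x`.
    have : ∃ w ∈ U.1 ⊓ V.1, w ≠ x := by
      by_contra! h
      apply hx
      convert (U.1 ⊓ V.1).isClopen.isOpen
      ext w
      exact ⟨fun e => e.symm ▸ ⟨hU, hV⟩, fun k => h w k⟩
    obtain ⟨w, hw, hwx⟩ := this
    obtain ⟨p, q, hp, hq, hpq⟩ := U.exists_notMem_pair
    refine ⟨⟨ofMem (U.1 ⊓ V.1) (a := x) (b := w) (c := p) (d := q) ⟨hU, hV⟩ hw hwx.symm
      (fun k => hp k.1) (fun k => hq k.1) hpq, ⟨hU, hV⟩⟩, ?_, ?_⟩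
    · exact φ.monotone fun _ k => k.1
    · exact φ.monotone fun _ k => k.2

theorem exists_point_map [CompactSpace E'] (hφ : ∀ U, φ Uᶜ = (φ U)ᶜ) (h5 : 5 ≤ ENat.card E)
    (x : E) : ∃ y, ∀ U : NonperipheralClopen E, y ∈ (φ U).1 ↔ x ∈ U.1 := by
  obtain ⟨y, hy⟩ : ∃ y, ∀ U : NonperipheralClopen E, x ∈ U.1 → y ∈ (φ U).1 := by
    by_cases hx : IsOpen {x}
    · exact exists_mem_map_of_isOpen hφ h5 hx
    · exact exists_mem_map_of_not_isOpen (le_trans (by norm_num) h5) hx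
  refine ⟨y, fun U => ⟨fun hU => ?_, hy U⟩⟩
  by_contra hx
  have := hy Uᶜ hx
  rw [hφ] at this
  exact this hU

/-- The non-peripheral clopen sets form a subbasis. -/
theorem exists_inter_subset (h4 : 4 ≤ ENat.card E) {O : Set E} (hO : IsOpen O) {x : E}
    (hx : x ∈ O) : ∃ U V : NonperipheralClopen E, x ∈ U.1 ∧ x ∈ V.1 ∧
      ∀ z, z ∈ U.1 → z ∈ V.1 → z ∈ O := by
  classical
  obtain ⟨a, hax, -⟩ := exists_ne_three h4 x x x
  obtain ⟨b, hbx, hba, -⟩ := exists_ne_three h4 x a a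
  obtain ⟨c, hcx, hca, hcb⟩ := exists_ne_three h4 x a b
  obtain ⟨G₀, hxG₀, hG₀⟩ := exists_clopen_mem_subset hO hx
  obtain ⟨G₁, hxG₁, hG₁⟩ := exists_clopen_separating x {a, b, c}
    (by simp [hax.symm, hbx.symm, hcx.symm])
  obtain ⟨H, haH, hH⟩ := exists_clopen_separating a {b, c} (by simp [hba.symm, hca.symm])
  obtain ⟨K, hbK, hK⟩ := exists_clopen_separating b {a, c} (by simp [hba, hcb.symm])
  have ha₁ : a ∉ G₁ := hG₁ a (by simp)
  have hb₁ : b ∉ G₁ := hG₁ b (by simp)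
  have hc₁ : c ∉ G₁ := hG₁ c (by simp)
  have hbH : b ∉ H := hH b (by simp)
  have hcH : c ∉ H := hH c (by simp)
  have haK : a ∉ K := hK a (by simp)
  have hcK : c ∉ K := hK c (by simp)
  -- The small neighbourhood `G₀ ∩ G₁` may be `{x}`; adding the disjoint sets `H` and `K \ H` makes
  -- it non-peripheral in two ways without changing the intersection.
  refine ⟨ofMem ((G₀ ⊓ G₁) ⊔ H) (a := x) (b := a) (c := b) (d := c) (Or.inl ⟨hxG₀, hxG₁⟩)
      (Or.inr haH) hax.symm (fun k => k.elim (fun k => hb₁ k.2) hbH)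
      (fun k => k.elim (fun k => hc₁ k.2) hcH) hcb.symm,
    ofMem ((G₀ ⊓ G₁) ⊔ (K ⊓ Hᶜ)) (a := x) (b := b) (c := a) (d := c) (Or.inl ⟨hxG₀, hxG₁⟩)
      (Or.inr ⟨hbK, hbH⟩) hbx.symm (fun k => k.elim (fun k => ha₁ k.2) (fun k => haK k.1))
      (fun k => k.elim (fun k => hc₁ k.2) (fun k => hcK k.1)) hca.symm,
    Or.inl ⟨hxG₀, hxG₁⟩, Or.inl ⟨hxG₀, hxG₁⟩, ?_⟩
  rintro z (hz | hz) hz'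
  · exact hG₀ hz.1
  · rcases hz' with hz' | hz'
    · exact hG₀ hz'.1
    · exact absurd hz hz'.2

theorem eq_of_forall_mem_iff (h4 : 4 ≤ ENat.card E) {x y : E}
    (h : ∀ U : NonperipheralClopen E, x ∈ U.1 ↔ y ∈ U.1) : x = y := by
  by_contra hxy
  obtain ⟨U, hx, hy⟩ := exists_mem_notMem h4 hxy
  exact hy ((h U).1 hx)

end Stone

/-! ### The homeomorphism induced by `φ` -/

theorem exists_homeomorph {E : Type*} [TopologicalSpace E] [CompactSpace E] [T2Space E]
    [TotallyDisconnectedSpace E] {E' : Type*} [TopologicalSpace E'] [CompactSpace E'] [T2Space E']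
    [TotallyDisconnectedSpace E'] (h5 : 5 ≤ ENat.card E) (h5' : 5 ≤ ENat.card E')
    (φ : NonperipheralClopen E ≃o NonperipheralClopen E') (hφ : ∀ U, φ Uᶜ = (φ U)ᶜ) :
    ∃ f : E ≃ₜ E', ∀ (U : NonperipheralClopen E) x, f x ∈ (φ U).1 ↔ x ∈ U.1 := by
  have h4 : 4 ≤ ENat.card E := le_trans (by norm_num) h5
  have h4' : 4 ≤ ENat.card E' := le_trans (by norm_num) h5'
  have hφ' : ∀ V, φ.symm Vᶜ = (φ.symm V)ᶜ := fun V => by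
    rw [OrderIso.symm_apply_eq, hφ, φ.apply_symm_apply]
  choose f hf using exists_point_map hφ h5
  choose g hg using exists_point_map hφ' h5'
  let e : E ≃ E' := ⟨f, g, fun x => eq_of_forall_mem_iff h4 fun U => by
      rw [← hf x U, ← hg (f x) (φ U), φ.symm_apply_apply],
    fun y => eq_of_forall_mem_iff h4' fun V => by
      rw [← hg y V, ← hf (g y) (φ.symm V), φ.apply_symm_apply]⟩
  have he : Continuous e := by
    rw [continuous_def]
    intro O hO
    rw [isOpen_iff_mem_nhds]
    intro x hx
    obtain ⟨U, V, hU, hV, hUV⟩ := exists_inter_subset h4' hO (x := f x) hx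
    rw [← φ.apply_symm_apply U, hf] at hU
    rw [← φ.apply_symm_apply V, hf] at hV
    refine Filter.mem_of_superset (Filter.inter_mem
      ((φ.symm U).1.isClopen.isOpen.mem_nhds hU) ((φ.symm V).1.isClopen.isOpen.mem_nhds hV)) ?_
    rintro z ⟨hzU, hzV⟩
    refine hUV (f z) ?_ ?_
    · rw [← φ.apply_symm_apply U, hf]
      exact hzU
    · rw [← φ.apply_symm_apply V, hf]
      exact hzV
  exact ⟨he.homeoOfEquivCompactToT2, fun U x => hf x U⟩

theorem toCut_eq_map {E E' : Type*} [TopologicalSpace E] [TopologicalSpace E'] (f : E ≃ₜ E')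
    {U : NonperipheralClopen E} {U' : NonperipheralClopen E'} (h : ∀ x, f x ∈ U'.1 ↔ x ∈ U.1) :
    U'.toCut.1 = U.toCut.1.map f := by
  have hU : clopenImage f U.1 = U'.1 := by
    refine Clopens.ext (Set.ext fun y => ⟨?_, fun hy => ⟨f.symm y, ?_, f.apply_symm_apply y⟩⟩)
    · rintro ⟨x, hx, rfl⟩
      exact (h x).2 hx
    · rw [← f.apply_symm_apply y] at hy
      exact (h _).1 hy
  apply Subtype.ext
  change s(U'.1, U'.1ᶜ) = Sym2.map (clopenImage f) s(U.1, U.1ᶜ)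
  rw [Sym2.map_mk, clopenImage_compl, hU]

/-! ### Spaces with four points -/

/-- In a finite space, two distinct points form a non-peripheral clopen set as soon as there are
four points. -/
theorem exists_eq_pair {E : Type*} [TopologicalSpace E] [Finite E] [T1Space E]
    (h4 : 4 ≤ ENat.card E) {x y : E} (hxy : y ≠ x) :
    ∃ U : NonperipheralClopen E, ∀ z, z ∈ U.1 ↔ z = x ∨ z = y := by
  obtain ⟨a, hax, hay, -⟩ := exists_ne_three h4 x y x
  obtain ⟨b, hbx, hby, hba⟩ := exists_ne_three h4 x y a
  let S : Clopens E := ⟨{x, y}, isClopen_discrete _⟩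
  have hS : ∀ z, z ∈ S ↔ z = x ∨ z = y := fun z => Iff.rfl
  exact ⟨ofMem S ((hS x).2 (Or.inl rfl)) ((hS y).2 (Or.inr rfl)) hxy.symm
    (fun k => ((hS a).1 k).elim hax hay) (fun k => ((hS b).1 k).elim hbx hby) hba.symm, hS⟩

/-- In a space with at most four points, a side containing `x` of a non-peripheral cut is `{x, y}`
for some `y`. -/
theorem exists_forall_mem_iff {E : Type*} [TopologicalSpace E] (h5 : ¬ 5 ≤ ENat.card E)
    {U : NonperipheralClopen E} {x : E} (hx : x ∈ U.1) :
    ∃ y ≠ x, ∀ z, z ∈ U.1 ↔ z = x ∨ z = y := by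
  obtain ⟨y, hy, hyx⟩ := U.exists_mem_ne x
  obtain ⟨p, q, hp, hq, hpq⟩ := U.exists_notMem_pair
  have ne : ∀ {u v : E}, u ∈ U.1 → v ∉ U.1 → u ≠ v := fun hu hv e => hv (e ▸ hu)
  refine ⟨y, hyx, fun z => ⟨fun hz => ?_, ?_⟩⟩
  · by_contra! h
    apply h5
    refine five_le_card (a := z) (b := x) (c := y) (d := p) (e := q) ?_
    simp [h.1, h.2, hyx.symm, hpq, ne hz hp, ne hz hq, ne hx hp, ne hx hq, ne hy hp, ne hy hq]
  · rintro (rfl | rfl) <;> assumption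

/-- In a space with four points, the cuts correspond to the points distinct from a given one. -/
theorem exists_equiv_cut {E : Type*} [TopologicalSpace E] [Finite E] [T1Space E]
    (h4 : 4 ≤ ENat.card E) (h5 : ¬ 5 ≤ ENat.card E) (x : E) :
    ∃ (U : {y // y ≠ x} → NonperipheralClopen E) (e : {y // y ≠ x} ≃ NonperipheralCut E),
      (∀ y, e y = (U y).toCut) ∧ ∀ y z, z ∈ (U y).1 ↔ z = x ∨ z = y.1 := by
  choose U hU using fun y : {y // y ≠ x} => exists_eq_pair h4 y.2
  have hbij : Function.Bijective fun y => (U y).toCut := by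
    constructor
    · intro y z h
      rcases toCut_eq_iff.1 h with h | h
      · have : y.1 ∈ (U z).1 := h ▸ (hU y y).2 (Or.inr rfl)
        exact Subtype.ext (((hU z y).1 this).resolve_left y.2)
      · have : x ∈ ((U z)ᶜ).1 := h ▸ (hU y x).2 (Or.inl rfl)
        exact absurd ((hU z x).2 (Or.inl rfl)) this
    · intro c
      obtain ⟨V, rfl, hV⟩ : ∃ V : NonperipheralClopen E, V.toCut = c ∧ x ∈ V.1 := by
        obtain ⟨V, rfl⟩ := toCut_surjective c
        by_cases hV : x ∈ V.1
        · exact ⟨V, rfl, hV⟩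
        · exact ⟨Vᶜ, toCut_compl V, hV⟩
      obtain ⟨y, hy, h⟩ := exists_forall_mem_iff h5 hV
      exact ⟨⟨y, hy⟩, congrArg toCut (ext_mem fun z => (hU _ z).trans (h z).symm)⟩
  exact ⟨U, Equiv.ofBijective _ hbij, fun _ => rfl, hU⟩

theorem exists_equiv_extending {α β : Type*} {x : α} {y : β} (τ : {a // a ≠ x} ≃ {b // b ≠ y}) :
    ∃ f : α ≃ β, f x = y ∧ ∀ a, f a.1 = (τ a).1 := by
  classical
  let f : α → β := fun a => if h : a = x then y else (τ ⟨a, h⟩).1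
  have hfx : f x = y := dif_pos rfl
  have hf : ∀ a, f a.1 = (τ a).1 := fun a => dif_neg a.2
  have hbij : Function.Bijective f := by
    constructor
    · intro a b h
      by_cases ha : a = x <;> by_cases hb : b = x
      · exact ha.trans hb.symm
      · rw [ha, hfx, hf ⟨b, hb⟩] at h
        exact absurd h.symm (τ ⟨b, hb⟩).2
      · rw [hb, hfx, hf ⟨a, ha⟩] at h
        exact absurd h (τ ⟨a, ha⟩).2
      · rw [hf ⟨a, ha⟩, hf ⟨b, hb⟩] at h
        exact congrArg Subtype.val (τ.injective (Subtype.ext h))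
    · intro b
      by_cases hb : b = y
      · exact ⟨x, hfx.trans hb.symm⟩
      · exact ⟨τ.symm ⟨b, hb⟩, by rw [hf, τ.apply_symm_apply]⟩
  exact ⟨Equiv.ofBijective f hbij, hfx, hf⟩

theorem finite_of_not_five_le {α : Type*} (h : ¬ 5 ≤ ENat.card α) : Finite α := by
  by_contra hinf
  rw [not_finite_iff_infinite] at hinf
  exact h (by rw [ENat.card_eq_top_of_infinite]; exact le_top)

/-- Between spaces with four points, every bijection of the sets of cuts is induced by a
homeomorphism. -/
theorem exists_homeomorph_of_card_eq_four {E E' : Type*} [TopologicalSpace E] [T2Space E]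
    [TopologicalSpace E'] [T2Space E'] (h4 : 4 ≤ ENat.card E) (h4' : 4 ≤ ENat.card E')
    (h5 : ¬ 5 ≤ ENat.card E) (h5' : ¬ 5 ≤ ENat.card E')
    (Φ : NonperipheralCut E ≃ NonperipheralCut E') :
    ∃ f : E ≃ₜ E', ∀ c : NonperipheralCut E, (Φ c).1 = c.1.map f := by
  have := finite_of_not_five_le h5
  have := finite_of_not_five_le h5'
  obtain ⟨x, -⟩ := exists_notMem_of_card_lt (n := 0) (lt_of_lt_of_le (by norm_num) h4)
    (∅ : Finset E) le_rfl
  obtain ⟨x', -⟩ := exists_notMem_of_card_lt (n := 0) (lt_of_lt_of_le (by norm_num) h4')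
    (∅ : Finset E') le_rfl
  obtain ⟨U, e, he, hU⟩ := exists_equiv_cut h4 h5 x
  obtain ⟨U', e', he', hU'⟩ := exists_equiv_cut h4' h5' x'
  -- Each cut is named by the partner of the base point; `f` sends `x` to `x'` and acts on partners
  -- as `Φ` acts on cuts.
  obtain ⟨f, hfx, hf⟩ := exists_equiv_extending ((e.trans Φ).trans e'.symm)
  refine ⟨⟨f, continuous_of_discreteTopology, continuous_of_discreteTopology⟩, fun c => ?_⟩
  obtain ⟨y, rfl⟩ := e.surjective c
  have hΦ : Φ (e y) = (U' (e'.symm (Φ (e y)))).toCut := by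
    rw [← he', e'.apply_symm_apply]
  rw [hΦ, he y]
  refine toCut_eq_map _ fun z => ?_
  rw [hU', hU]
  change f z = x' ∨ f z = _ ↔ _
  have hz : f z = x' ↔ z = x := by rw [← f.apply_eq_iff_eq, hfx]
  have hy : (e'.symm (Φ (e y))).1 = f y := (hf y).symm
  rw [hz, ← he y, hy, f.apply_eq_iff_eq]

end NonperipheralClopen

open NonperipheralClopen in
theorem mainTheorem2 {E : Type*} {E' : Type*}
    [TopologicalSpace E] [CompactSpace E] [T2Space E] [TotallyDisconnectedSpace E]
    [SecondCountableTopology E]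
    [TopologicalSpace E'] [CompactSpace E'] [T2Space E'] [TotallyDisconnectedSpace E']
    [SecondCountableTopology E']
    (hE : 4 ≤ ENat.card E) (hE' : 4 ≤ ENat.card E')
    (Φ : cutComplex E ≃g cutComplex E') :
    ∃ f : E ≃ₜ E', ∀ c : NonperipheralCut E, (Φ c).1 = c.1.map f := by
  by_cases h5 : 5 ≤ ENat.card E
  · have h5' : 5 ≤ ENat.card E' := by
      obtain ⟨c, d, h⟩ := exists_adj h5
      exact five_le_card_of_adj (Φ.map_adj_iff.2 h)
    obtain ⟨φ, hφ, hφΦ⟩ := exists_orderIso h5 h5' Φ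
    obtain ⟨f, hf⟩ := exists_homeomorph h5 h5' φ hφ
    refine ⟨f, fun c => ?_⟩
    obtain ⟨U, rfl⟩ := toCut_surjective c
    rw [← hφΦ]
    exact toCut_eq_map f (hf U)
  · have h5' : ¬ 5 ≤ ENat.card E' := fun h => by
      obtain ⟨c, d, h⟩ := exists_adj h
      exact h5 (five_le_card_of_adj (Φ.symm.map_adj_iff.2 h))
    exact exists_homeomorph_of_card_eq_four hE hE' h5 h5' Φ.toEquiv
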